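/- For a positive integer $X$ and a function $f$ on $[0,X]$ let $E_X(f(x))=\frac1X\int_0^X f(x)\,dx$ be the expected value for $x$ uniformly distributed on $[0,X]$; let $\{y\}=y-\lfloor y\rfloor$ denote the fractional part of $y$, $\mu$ the Möbius function and $\zeta$ the Riemann zeta function. For every positive integer $X$ the limit $$S(X)=\sum_{n\neq m}\frac{\mu(n)\mu(m)}{nm}E_X(\{nx\}\{mx\}):=\lim_{N\to\infty}\sum_{\substack{1\le n,m\le N\\ n\neq m}}\frac{\mu(n)\mu(m)}{nm}E_X(\{nx\}\{mx\})$$ exists, and $$S(X)=-\frac{9}{2\pi^2}+O\left(\frac1X\right),$$ where the implied constant is absolute, i.e. there is a constant $C$ with $|S(X)+9/(2\pi^2)|\le C/X$ for all integers $X\ge1$. Moreover, $E_X(\sin^2(2\pi x))=\frac12+O(1/X)$ for integers $X\ge 1$ with an absolute implied constant; $E_X(\{nx\}^2)=\frac13$ for all integers $n,X\ge1$; and $$\sum_{n=1}^\infty\frac{\mu(n)^2}{n^2}=\frac{\zeta(2)}{\zeta(4)}=\frac{15}{\pi^2}.$$ -/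

import Mathlib

/-- The expected value `(1/X) ∫₀^X f(x) dx` of `f(x)` for `x` uniformly distributed on `[0, X]`. -/
noncomputable def expectedValue (X : ℕ) (f : ℝ → ℝ) : ℝ :=
  (1 / (X : ℝ)) * ∫ x in (0 : ℝ)..(X : ℝ), f x

/-- The partial sum over `1 ≤ n, m ≤ N`, `n ≠ m`, of
`μ(n) μ(m) / (n m) * E_X({n x} {m x})`. -/
noncomputable def offDiagonalSum (X N : ℕ) : ℝ :=
  ∑ p ∈ (Finset.Icc 1 N).offDiag,
    ((ArithmeticFunction.moebius p.1 : ℝ) * (ArithmeticFunction.moebius p.2 : ℝ)) /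
      ((p.1 : ℝ) * (p.2 : ℝ)) *
      expectedValue X (fun x => Int.fract ((p.1 : ℝ) * x) * Int.fract ((p.2 : ℝ) * x))

/-!
The functions `{n x}` have period `1`, so for integral `X` the means over `[0, X]` are integrals over
one period, and `∫₀¹ {n x} {m x} dx = 1/4 + gcd(n, m)² / (12 n m)` (`integral_fract_mul_fract`). The
off-diagonal sum up to `N` is therefore independent of `X` and equals
`1/4 (∑ μ(n)/n)² + 1/12 ∑ μ(n) μ(m) / lcm(n, m)² - 1/3 ∑ μ(n)² / n²` (`offDiagonalSum_eq`). The three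
terms converge separately, to `0`, `1/12 · 6/π²` and `1/3 · 15/π²`, and the total is `-9/(2π²)`.

The first limit, `∑ μ(n)/n = 0` (`tendsto_moebiusDivSum`), is equivalent to the prime number theorem.
It is derived from a Tauberian theorem (`tendsto_zero_of_laplace_continuousOn`) applied to
`α(t) = ∑_{n ≤ exp t} μ(n)/n`, whose Laplace transform `1 / (s ζ(1 + s))` extends continuously to
`re s ≥ 0` because `ζ` does not vanish on the line `re s = 1`. The Tauberian theorem smooths `α` by a
kernel whose Fourier transform has compact support; the Riemann–Lebesgue lemma shows that the smoothed
function tends to zero, and slow oscillation of `α` removes the smoothing.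

For the second limit, `ζ(2) / lcm(n, m)²` is the sum of `1/k²` over the common multiples `k` of `n` and
`m`, so `ζ(2)` times the double sum is `∑ (∑_{n ∣ k, n ≤ N} μ(n))² / k²`, which tends to its term
`k = 1` by dominated convergence (`tendsto_sum_moebius_mul_moebius_div_lcm_sq`). The third follows from
Euler products (`hasSum_moebius_sq_div_sq`).
-/

/-! ### A Tauberian theorem for Laplace transforms -/

section

open MeasureTheory Filter Topology FourierTransform SchwartzMap Complex

/-- For a damping `ε > 0`, self-adjointness of the Fourier transform moves it from the translated
kernel onto `α t * exp (-ε t)`, where it gives the Laplace transform `H` on the line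
`re s = ε`. -/
lemma integral_fourier_shift_mul_damped {α : ℝ → ℂ} (hm : Measurable α) {M : ℝ}
    (hM : ∀ t, ‖α t‖ ≤ M) (h0 : ∀ t < 0, α t = 0) {H : ℂ → ℂ}
    (hL : ∀ s : ℂ, 0 < s.re → ∫ t : ℝ, α t * cexp (-s * t) = H s)
    (φ : 𝓢(ℝ, ℂ)) (T : ℝ) {ε : ℝ} (hε : 0 < ε) :
    ∫ t : ℝ, 𝓕 (φ : ℝ → ℂ) (t - T) * (α t * cexp (-ε * t)) =
      ∫ v : ℝ, (Real.fourierChar (v * T) • φ v) * H (ε + 2 * Real.pi * v * I) := by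
  have hf : Integrable (fun v : ℝ => Real.fourierChar (v * T) • φ v) := by
    have := φ.integrable (μ := volume)
    refine (integrable_norm_iff ?_).1 ?_
    · have : Continuous (fun v : ℝ => Real.fourierChar (v * T) • φ v) := by fun_prop
      exact this.aestronglyMeasurable
    · simpa [Circle.norm_smul] using this.norm
  have hg : Integrable (fun t : ℝ => α t * cexp (-ε * t)) := by
    have h1 : IntegrableOn (fun t : ℝ => M * Real.exp (-ε * t)) (Set.Ici 0) := by
      rw [integrableOn_Ici_iff_integrableOn_Ioi]
      exact (integrableOn_exp_mul_Ioi (by linarith) 0).const_mul M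
    have h2 : IntegrableOn (fun t : ℝ => α t * cexp (-ε * t)) (Set.Ici 0) := by
      refine h1.mono' (by fun_prop) (Eventually.of_forall fun t => ?_)
      rw [norm_mul, Complex.norm_exp]
      simp
      gcongr
      exact hM t
    refine (integrableOn_iff_integrable_of_support_subset fun t ht => ?_).1 h2
    by_contra h
    exact ht (by simp [h0 t (by simpa using h)])
  have hF (t : ℝ) : VectorFourier.fourierIntegral Real.fourierChar volume (innerₗ ℝ)
      (fun v : ℝ => Real.fourierChar (v * T) • φ v) t = 𝓕 (φ : ℝ → ℂ) (t - T) := by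
    rw [Real.fourier_real_eq]
    simp only [VectorFourier.fourierIntegral]
    congr 1
    ext v
    rw [← mul_smul, ← AddChar.map_add_eq_mul]
    congr 2
    simp
    ring
  have hG (v : ℝ) : VectorFourier.fourierIntegral Real.fourierChar volume (innerₗ ℝ).flip
      (fun t : ℝ => α t * cexp (-ε * t)) v = H (ε + 2 * Real.pi * v * I) := by
    rw [← hL _ (by simpa using hε)]
    simp only [VectorFourier.fourierIntegral]
    congr 1
    ext t
    simp only [Circle.smul_def, Real.fourierChar_apply, smul_eq_mul]
    rw [mul_left_comm, ← Complex.exp_add]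
    congr 2
    simp
    ring
  have key := VectorFourier.integral_fourierIntegral_smul_eq_flip (μ := volume) (ν := volume)
    (L := innerₗ ℝ) Real.continuous_fourierChar continuous_inner hf hg
  simpa only [smul_eq_mul, hF, hG] using key

/-- The limit `ε → 0` of the damped identity: the smoothing of `α` by the kernel `𝓕 φ` is itself the
Fourier transform of `φ` times the boundary values of `H`. Compact support of `φ` is what allows the
limit on the right, as nothing is known about the growth of `H` along vertical lines. -/
lemma integral_fourier_shift_mul {α : ℝ → ℂ} (hm : Measurable α) {M : ℝ}
    (hM : ∀ t, ‖α t‖ ≤ M) (h0 : ∀ t < 0, α t = 0) {H : ℂ → ℂ}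
    (hH : ContinuousOn H {s | 0 ≤ s.re})
    (hL : ∀ s : ℂ, 0 < s.re → ∫ t : ℝ, α t * cexp (-s * t) = H s)
    (φ : 𝓢(ℝ, ℂ)) (hφ : HasCompactSupport φ) (T : ℝ) :
    ∫ t : ℝ, 𝓕 (φ : ℝ → ℂ) (t - T) * α t =
      𝓕 (fun v : ℝ => φ v * H (2 * Real.pi * v * I)) (-T) := by
  have hK : Integrable (fun t : ℝ => 𝓕 (φ : ℝ → ℂ) (t - T)) := by
    rw [← SchwartzMap.fourier_coe]
    exact (SchwartzMap.integrable (μ := volume) (𝓕 φ)).comp_sub_right T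
  have hKc : Continuous (𝓕 (φ : ℝ → ℂ)) := by
    rw [← SchwartzMap.fourier_coe]
    exact (𝓕 φ).continuous
  have hpos : ∀ᶠ ε : ℝ in 𝓝[>] 0, 0 < ε := eventually_mem_nhdsWithin
  have hlim1 : Tendsto (fun ε : ℝ => ∫ t : ℝ, 𝓕 (φ : ℝ → ℂ) (t - T) * (α t * cexp (-ε * t)))
      (𝓝[>] 0) (𝓝 (∫ t : ℝ, 𝓕 (φ : ℝ → ℂ) (t - T) * α t)) := by
    refine tendsto_integral_filter_of_dominated_convergence
      (fun t => ‖𝓕 (φ : ℝ → ℂ) (t - T)‖ * M) ?_ ?_ (hK.norm.mul_const M) ?_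
    · refine Eventually.of_forall fun ε => Measurable.aestronglyMeasurable ?_
      have := hKc.measurable
      fun_prop
    · filter_upwards [hpos] with ε hε
      refine Eventually.of_forall fun t => ?_
      rw [norm_mul, norm_mul]
      gcongr
      rcases lt_or_ge t 0 with ht | ht
      · simpa [h0 t ht] using (norm_nonneg _).trans (hM 0)
      · refine (mul_le_of_le_one_right (norm_nonneg _) ?_).trans (hM t)
        rw [Complex.norm_exp]
        simpa using mul_nonneg hε.le ht
    · refine Eventually.of_forall fun t => ?_
      have : Continuous (fun ε : ℝ => 𝓕 (φ : ℝ → ℂ) (t - T) * (α t * cexp (-ε * t))) := by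
        fun_prop
      simpa using (this.tendsto 0).mono_left nhdsWithin_le_nhds
  have hpath : ContinuousOn (fun p : ℝ × ℝ => H (p.1 + 2 * Real.pi * p.2 * I))
      {p | 0 ≤ p.1} := by
    refine hH.comp (by fun_prop) fun p hp => ?_
    simpa using hp
  have hlim2 : Tendsto (fun ε : ℝ => ∫ v : ℝ, (Real.fourierChar (v * T) • φ v) *
      H (ε + 2 * Real.pi * v * I)) (𝓝[>] 0) (𝓝 (∫ v : ℝ, (Real.fourierChar (v * T) • φ v) *
      H ((0 : ℝ) + 2 * Real.pi * v * I))) := by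
    obtain ⟨B, hB⟩ := ((isCompact_Icc (a := (0 : ℝ)) (b := 1)).prod hφ).exists_bound_of_continuousOn
      (hpath.mono fun p hp => hp.1.1)
    refine tendsto_integral_filter_of_dominated_convergence
      (fun v => ‖φ v‖ * B) ?_ ?_ (((φ.integrable (μ := volume)).norm).mul_const B) ?_
    · filter_upwards [hpos] with ε hε
      refine Continuous.aestronglyMeasurable ?_
      have : Continuous (fun v : ℝ => H (ε + 2 * Real.pi * v * I)) :=
        hpath.comp_continuous (f := fun v : ℝ => (ε, v)) (by fun_prop) fun v => hε.le
      have hc : Continuous (fun v : ℝ => Real.fourierChar (v * T) • φ v) := by fun_prop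
      exact hc.mul this
    · filter_upwards [hpos, (eventually_lt_nhds zero_lt_one).filter_mono nhdsWithin_le_nhds]
        with ε hε hε1
      refine Eventually.of_forall fun v => ?_
      rw [norm_mul, Circle.norm_smul]
      by_cases hv : v ∈ tsupport φ
      · gcongr
        exact hB (ε, v) ⟨⟨hε.le, hε1.le⟩, hv⟩
      · simp [image_eq_zero_of_notMem_tsupport hv]
    · refine Eventually.of_forall fun v => ?_
      refine Tendsto.mul tendsto_const_nhds ?_
      have := (hpath (0, v) (le_refl (0 : ℝ))).tendsto
      refine this.comp (tendsto_nhdsWithin_iff.2 ⟨?_, ?_⟩) (f := fun ε : ℝ => (ε, v))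
      · exact (Continuous.tendsto (by fun_prop) (0 : ℝ)).mono_left nhdsWithin_le_nhds
      · filter_upwards [hpos] with ε hε using hε.le
  have heq := tendsto_nhds_unique hlim1 (hlim2.congr' ?_)
  · rw [heq, Real.fourier_real_eq]
    congr 1
    ext v
    simp [smul_mul_assoc]
  · filter_upwards [hpos] with ε hε
    exact (integral_fourier_shift_mul_damped hm hM h0 hL φ T hε).symm

/-- By the Riemann–Lebesgue lemma, the smoothings of `α` by translates of `𝓕 φ` tend to zero. -/
lemma tendsto_integral_fourier_shift_mul {α : ℝ → ℂ} (hm : Measurable α) {M : ℝ}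
    (hM : ∀ t, ‖α t‖ ≤ M) (h0 : ∀ t < 0, α t = 0) {H : ℂ → ℂ}
    (hH : ContinuousOn H {s | 0 ≤ s.re})
    (hL : ∀ s : ℂ, 0 < s.re → ∫ t : ℝ, α t * cexp (-s * t) = H s)
    (φ : 𝓢(ℝ, ℂ)) (hφ : HasCompactSupport φ) :
    Tendsto (fun T : ℝ => ∫ t : ℝ, 𝓕 (φ : ℝ → ℂ) (t - T) * α t) atTop (𝓝 0) := by
  simp_rw [integral_fourier_shift_mul hm hM h0 hH hL φ hφ]
  exact (Real.zero_at_infty_fourier _).comp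
    (tendsto_neg_atTop_atBot.mono_right (by rw [cocompact_eq_atBot_atTop]; exact le_sup_left))

lemma exists_schwartz_compactSupport_integral_fourier_eq_one :
    ∃ φ : 𝓢(ℝ, ℂ), HasCompactSupport φ ∧ ∫ t : ℝ, 𝓕 (φ : ℝ → ℂ) t = 1 := by
  let b : ContDiffBump (0 : ℝ) := ⟨1, 2, one_pos, one_lt_two⟩
  have hc : HasCompactSupport (fun x => (b x : ℂ)) :=
    HasCompactSupport.comp_left (g := Complex.ofReal) b.hasCompactSupport Complex.ofReal_zero
  have hs : ContDiff ℝ (⊤ : ℕ∞) (fun x => (b x : ℂ)) :=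
    Complex.ofRealCLM.contDiff.comp b.contDiff
  refine ⟨hc.toSchwartzMap hs, hc, ?_⟩
  set φ := hc.toSchwartzMap hs
  have hi : Integrable (𝓕 (φ : ℝ → ℂ)) := by
    rw [← SchwartzMap.fourier_coe]
    exact (𝓕 φ).integrable
  have h := congrFun (φ.continuous.fourierInv_fourier_eq φ.integrable hi) 0
  rw [Real.fourierInv_eq'] at h
  have hφ0 : φ 0 = 1 := by
    change (b 0 : ℂ) = 1
    rw [b.one_of_mem_closedBall (Metric.mem_closedBall_self b.rIn_pos.le)]
    simp
  simpa [hφ0] using h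

/-- A Tauberian theorem of Newman–Ingham type: a bounded function on `[0, ∞)`, slowly oscillating in
the sense of `hosc`, whose Laplace transform extends continuously to the closed half-plane
`0 ≤ re s`, tends to zero. Smoothing at scale `1 / l` gives a quantity tending to zero, and by slow
oscillation the smoothing differs from `α` by `O(1 / l)` up to an arbitrarily small error. -/
theorem tendsto_zero_of_laplace_continuousOn {α : ℝ → ℂ} (hm : Measurable α) {M : ℝ}
    (hM : ∀ t, ‖α t‖ ≤ M) (h0 : ∀ t < 0, α t = 0) {H : ℂ → ℂ}
    (hH : ContinuousOn H {s | 0 ≤ s.re})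
    (hL : ∀ s : ℂ, 0 < s.re → ∫ t : ℝ, α t * cexp (-s * t) = H s)
    (hosc : ∀ δ > 0, ∃ T₀, ∀ t t', T₀ ≤ t → t ≤ t' → ‖α t' - α t‖ ≤ (t' - t) + δ) :
    Tendsto α atTop (𝓝 0) := by
  obtain ⟨φ, hφ, hφ1⟩ := exists_schwartz_compactSupport_integral_fourier_eq_one
  have hM0 : 0 ≤ M := (norm_nonneg _).trans (hM 0)
  -- Boundedness extends the oscillation estimate to all `t`, for the price of a factor `2`.
  have hosc' : ∀ δ > 0, ∀ᶠ T in atTop, ∀ t, ‖α t - α T‖ ≤ 2 * |t - T| + δ := by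
    intro δ hδ
    obtain ⟨T₀, hT₀⟩ := hosc δ hδ
    filter_upwards [eventually_ge_atTop (T₀ + M)] with T hT t
    rcases lt_or_ge t T₀ with ht | ht
    · have := norm_sub_le (α t) (α T)
      have := hM t
      have := hM T
      have := neg_le_abs (t - T)
      linarith
    · rcases le_total t T with h | h
      · have := hT₀ t T ht h
        rw [norm_sub_rev, abs_sub_comm, abs_of_nonneg (by linarith)]
        linarith
      · have := hT₀ T t (by linarith) h
        rw [abs_of_nonneg (by linarith)]
        linarith
  set K : ℝ → ℂ := 𝓕 (φ : ℝ → ℂ)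
  have hKS : K = (𝓕 φ : 𝓢(ℝ, ℂ)) := rfl
  have hK : Integrable K := by rw [hKS]; exact SchwartzMap.integrable _
  have hK1 : Integrable (fun t => |t| * ‖K t‖) := by
    have := SchwartzMap.integrable_pow_mul volume (𝓕 φ) 1
    simpa [hKS] using this
  set C₀ := ∫ t, ‖K t‖
  set C₁ := ∫ t, |t| * ‖K t‖
  have hC₀ : 0 ≤ C₀ := integral_nonneg fun t => norm_nonneg _
  have hC₁ : 0 ≤ C₁ := integral_nonneg fun t => by positivity
  rw [Metric.tendsto_atTop']
  intro η hη
  -- The scale `1 / l` and the oscillation error `δ` make the final bound `η / 4 + η / 4 + η / 4`.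
  obtain ⟨l, hl, hlη⟩ : ∃ l : ℝ, 0 < l ∧ 2 / l * C₁ ≤ η / 4 := by
    refine ⟨8 * (C₁ + 1) / η, by positivity, ?_⟩
    rw [div_div_eq_mul_div, div_mul_eq_mul_div, div_le_div_iff₀ (by positivity) (by norm_num)]
    nlinarith
  obtain ⟨δ, hδ, hδη⟩ : ∃ δ : ℝ, 0 < δ ∧ δ * C₀ ≤ η / 4 := by
    refine ⟨η / (4 * (C₀ + 1)), by positivity, ?_⟩
    rw [div_mul_eq_mul_div, div_le_div_iff₀ (by positivity) (by norm_num)]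
    nlinarith
  -- Stretching `α` by `l` replaces rescaling the kernel; its Laplace transform is `l * H (l * s)`.
  have hlim := tendsto_integral_fourier_shift_mul (α := fun t => α (t / l)) (by fun_prop)
    (fun t => hM _) (fun t ht => h0 _ (div_neg_of_neg_of_pos ht hl)) (H := fun s => l * H (l * s))
    (continuousOn_const.mul (hH.comp (by fun_prop) fun s hs => by
      simpa using mul_nonneg hl.le hs)) (fun s hs => by
      rw [← hL (l * s) (by simpa using mul_pos hl hs)]
      have := Measure.integral_comp_div (fun t : ℝ => α t * cexp (-(l * s) * t)) l
      rw [abs_of_pos hl, Complex.real_smul] at this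
      rw [← this]
      congr 1
      ext t
      congr 2
      push_cast
      have : (l : ℂ) ≠ 0 := by exact_mod_cast hl.ne'
      field_simp) φ hφ
  have hscale : Tendsto (fun T : ℝ => T * l) atTop atTop := tendsto_id.atTop_mul_const hl
  have hev := ((hlim.comp hscale).norm.eventually_lt_const
    (show ‖(0 : ℂ)‖ < η / 4 by simpa using by positivity)).and (hosc' δ hδ)
  obtain ⟨N, hN⟩ := eventually_atTop.1 hev
  refine ⟨N, fun T hT => ?_⟩
  obtain ⟨h1, h2⟩ := hN T hT.le
  simp only [Function.comp_apply] at h1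
  have hKT : Integrable (fun t => K (t - T * l)) := hK.comp_sub_right _
  have hmass : ∫ t, K (t - T * l) * α T = α T := by
    rw [integral_mul_const, integral_sub_right_eq_self K, hφ1, one_mul]
  have hi1 : Integrable (fun t => K (t - T * l) * α (t / l)) :=
    hKT.mul_bdd (c := M) (by exact Measurable.aestronglyMeasurable (by fun_prop))
      (Eventually.of_forall fun t => hM _)
  have hi2 : Integrable (fun t => K (t - T * l) * α T) := hKT.mul_const _
  have hdiff : ‖∫ t, K (t - T * l) * α (t / l) - K (t - T * l) * α T‖ ≤ 2 / l * C₁ + δ * C₀ := by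
    have hb : ∫ t, (2 / l * (|t - T * l| * ‖K (t - T * l)‖) + δ * ‖K (t - T * l)‖) =
        2 / l * C₁ + δ * C₀ := by
      rw [integral_sub_right_eq_self
          (fun t => 2 / l * (|t| * ‖K t‖) + δ * ‖K t‖) (T * l),
        integral_add (hK1.const_mul _) (hK.norm.const_mul _), integral_const_mul,
        integral_const_mul]
    rw [← hb]
    refine norm_integral_le_of_norm_le ?_ (Eventually.of_forall fun t => ?_)
    · exact ((hK1.const_mul (2 / l)).add (hK.norm.const_mul δ)).comp_sub_right (T * l)
    · rw [← mul_sub, norm_mul]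
      have h3 := h2 (t / l)
      have h4 : t / l - T = (t - T * l) / l := by field_simp
      rw [h4, abs_div, abs_of_pos hl] at h3
      calc _ ≤ ‖K (t - T * l)‖ * (2 * (|t - T * l| / l) + δ) := by gcongr
        _ = _ := by ring
  rw [integral_sub hi1 hi2, hmass] at hdiff
  rw [dist_zero_right]
  have := norm_sub_norm_le (α T) (∫ t, K (t - T * l) * α (t / l))
  rw [norm_sub_rev] at this
  linarith

end

/-! ### Convergence of `∑ μ(n) / n` to zero -/

section

open MeasureTheory Filter Topology Complex Finset ArithmeticFunction

/-- The partial sum `∑_{k ≤ n} μ(k) / k`. -/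
noncomputable def moebiusDivSum (n : ℕ) : ℝ :=
  ∑ k ∈ Icc 1 n, (moebius k : ℝ) / k

lemma abs_moebius_cast_le_one (k : ℕ) : |(moebius k : ℝ)| ≤ 1 := by
  exact_mod_cast abs_moebius_le_one (n := k)

/-- Counting `∑ k ≤ n, μ(k) ⌊n / k⌋ = 1` and replacing each floor by `n / k` costs at most `n`. -/
lemma abs_moebiusDivSum_le_two (n : ℕ) : |moebiusDivSum n| ≤ 2 := by
  rcases Nat.eq_zero_or_pos n with rfl | hn
  · simp [moebiusDivSum]
  have hn' : (0 : ℝ) < n := by exact_mod_cast hn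
  have h1 : ∑ k ∈ Icc 1 n, (moebius k : ℝ) * ((n / k : ℕ) : ℝ) = 1 := by
    have h := sum_Ioc_mul_zeta_eq_sum (moebius : ArithmeticFunction ℤ) n
    rw [moebius_mul_coe_zeta] at h
    have h2 : ∑ k ∈ Ioc 0 n, (1 : ArithmeticFunction ℤ) k = 1 := by
      rw [sum_eq_single_of_mem 1 (by simp; omega) fun b _ hb => one_apply_ne hb]
      simp
    rw [h2] at h
    rw [show Icc 1 n = Ioc 0 n by ext; simp; omega]
    have h3 := congrArg (Int.cast (R := ℝ)) h
    push_cast at h3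
    exact h3.symm
  have h2 : |n * moebiusDivSum n - 1| ≤ n := by
    rw [← h1, moebiusDivSum, mul_sum, ← sum_sub_distrib]
    refine (abs_sum_le_sum_abs _ _).trans ((sum_le_card_nsmul _ _ 1 fun k hk => ?_).trans (by simp))
    have hk0 : (0 : ℝ) < k := by exact_mod_cast (mem_Icc.1 hk).1
    have h3 : (n : ℝ) * (moebius k / k) - moebius k * ((n / k : ℕ) : ℝ) =
        moebius k * ((n : ℝ) / k - ((n / k : ℕ) : ℝ)) := by ring
    rw [h3, abs_mul]
    refine mul_le_one₀ (abs_moebius_cast_le_one k) (abs_nonneg _) ?_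
    rw [← Nat.floor_div_eq_div (K := ℝ), abs_le]
    have := Nat.floor_le (show (0 : ℝ) ≤ n / k by positivity)
    have := Nat.lt_floor_add_one ((n : ℝ) / k)
    constructor <;> linarith
  have h3 : (1 : ℝ) ≤ n := by exact_mod_cast hn
  rw [abs_le] at h2 ⊢
  constructor <;> nlinarith

lemma sum_Ioc_one_div_le_log_sub_log {m n : ℕ} (hm : 1 ≤ m) (hmn : m ≤ n) :
    ∑ k ∈ Ioc m n, (1 : ℝ) / k ≤ Real.log n - Real.log m := by
  induction n, hmn using Nat.le_induction with
  | base => simp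
  | succ n hn ih =>
    rw [← Finset.insert_Ioc_right_eq_Ioc_add_one hn, sum_insert (by simp)]
    have hn0 : (0 : ℝ) < n := by exact_mod_cast hm.trans hn
    have h := Real.one_sub_inv_le_log_of_pos (show (0 : ℝ) < (n + 1) / n by positivity)
    rw [Real.log_div (by positivity) (by positivity)] at h
    have h2 : 1 - (((n : ℝ) + 1) / n)⁻¹ = 1 / (n + 1) := by field_simp; ring
    rw [h2] at h
    push_cast
    linarith

lemma abs_moebiusDivSum_sub_le {m n : ℕ} (hm : 1 ≤ m) (hmn : m ≤ n) :
    |moebiusDivSum n - moebiusDivSum m| ≤ Real.log n - Real.log m := by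
  have h : moebiusDivSum n - moebiusDivSum m = ∑ k ∈ Ioc m n, (moebius k : ℝ) / k := by
    rw [moebiusDivSum, moebiusDivSum, sub_eq_iff_eq_add, add_comm, ← sum_union]
    · congr 1
      ext k
      simp
      omega
    · rw [disjoint_left]
      intro k
      simp
      omega
  rw [h]
  refine (abs_sum_le_sum_abs _ _).trans (le_trans (sum_le_sum fun k _ => ?_)
    (sum_Ioc_one_div_le_log_sub_log hm hmn))
  rw [abs_div, Nat.abs_cast]
  gcongr
  exact abs_moebius_cast_le_one k

lemma moebiusDivSum_floor_exp_slowly_oscillating {δ : ℝ} (hδ : 0 < δ) :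
    ∃ T₀, ∀ t t', T₀ ≤ t → t ≤ t' →
      |moebiusDivSum ⌊Real.exp t'⌋₊ - moebiusDivSum ⌊Real.exp t⌋₊| ≤ (t' - t) + δ := by
  -- Passing from `exp t` to its floor costs `1 / ⌊exp t⌋`, at most `δ` once `exp t ≥ 1 + 1 / δ`.
  refine ⟨Real.log (1 + 1 / δ), fun t t' ht htt' => ?_⟩
  have hx : 1 + 1 / δ ≤ Real.exp t := (Real.log_le_iff_le_exp (by positivity)).1 ht
  have hδ' : 0 < 1 / δ := by positivity
  have hm : 1 ≤ ⌊Real.exp t⌋₊ := Nat.le_floor (by push_cast; linarith)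
  have hmn : ⌊Real.exp t⌋₊ ≤ ⌊Real.exp t'⌋₊ := Nat.floor_mono (Real.exp_le_exp.2 htt')
  refine (abs_moebiusDivSum_sub_le hm hmn).trans ?_
  have hm0 : (0 : ℝ) < ⌊Real.exp t⌋₊ := by exact_mod_cast hm
  have hn0 : (0 : ℝ) < ⌊Real.exp t'⌋₊ := by exact_mod_cast hm.trans hmn
  have h1 : Real.log ⌊Real.exp t'⌋₊ ≤ t' := by
    rw [Real.log_le_iff_le_exp hn0]
    exact Nat.floor_le (Real.exp_pos _).le
  have h2 : t - Real.log ⌊Real.exp t⌋₊ ≤ δ := by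
    have h3 := Real.log_le_sub_one_of_pos (div_pos (Real.exp_pos t) hm0)
    rw [Real.log_div (Real.exp_pos t).ne' hm0.ne', Real.log_exp] at h3
    refine h3.trans ?_
    have h4 := Nat.lt_floor_add_one (Real.exp t)
    rw [sub_le_iff_le_add, div_le_iff₀ hm0]
    have h5 : 1 / δ ≤ ⌊Real.exp t⌋₊ := by linarith
    rw [div_le_iff₀ hδ] at h5
    nlinarith
  linarith

/-- `1 / (s ζ(1 + s))`, with the removable singularity at `s = 0` filled in. -/
noncomputable def invSMulZeta (s : ℂ) : ℂ :=
  (Function.update (fun z => (z - 1) * riemannZeta z) 1 1 (1 + s))⁻¹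

lemma invSMulZeta_apply {s : ℂ} (hs : s ≠ 0) : invSMulZeta s = (s * riemannZeta (1 + s))⁻¹ := by
  simp [invSMulZeta, hs]

/-- The analytic input of the prime number theorem: `ζ` has no zeros on the line `re s = 1`, and its
pole at `1` cancels the factor `s`. -/
lemma continuousOn_invSMulZeta : ContinuousOn invSMulZeta {s | 0 ≤ s.re} := by
  have hc : Continuous (Function.update (fun z => (z - 1) * riemannZeta z) 1 1) := by
    rw [continuous_iff_continuousAt]
    intro z
    rcases eq_or_ne z 1 with rfl | hz
    · exact continuousAt_update_same.2 riemannZeta_residue_one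
    · rw [continuousAt_update_of_ne hz]
      exact (by fun_prop : ContinuousAt (fun z : ℂ => z - 1) z).mul
        (differentiableAt_riemannZeta hz).continuousAt
  refine (hc.comp (by fun_prop : Continuous fun s : ℂ => 1 + s)).continuousOn.inv₀ fun s hs => ?_
  rcases eq_or_ne s 0 with rfl | hs0
  · simp
  · have := riemannZeta_ne_zero_of_one_le_re (s := 1 + s) (by simpa using hs)
    simp [hs0, this]

/-- Abel summation of the Dirichlet series of `μ(n) / n`, in the logarithmic variable `t`. -/
lemma integral_moebiusDivSum_mul_exp {s : ℂ} (hs : 0 < s.re) :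
    ∫ t : ℝ, (moebiusDivSum ⌊Real.exp t⌋₊ : ℂ) * cexp (-s * t) = invSMulZeta s := by
  have hs0 : s ≠ 0 := by rintro rfl; simp at hs
  have hs1 : 1 < (s + 1).re := by simpa using hs
  set f : ℕ → ℂ := fun n => (moebius n : ℂ) / n
  have hterm : LSeries.term f s = LSeries.term (fun n => (moebius n : ℂ)) (s + 1) := by
    ext n
    rcases eq_or_ne n 0 with rfl | hn
    · simp
    · have : (n : ℂ) ≠ 0 := by exact_mod_cast hn
      rw [LSeries.term_of_ne_zero hn, LSeries.term_of_ne_zero hn, Complex.cpow_add _ _ this,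
        Complex.cpow_one, div_div, mul_comm]
  have hsum : LSeriesSummable f s := by
    rw [LSeriesSummable, hterm]
    exact LSeriesSummable_moebius_iff.2 hs1
  have hval : LSeries f s = (riemannZeta (1 + s))⁻¹ := by
    have h := LSeries_one_mul_Lseries_moebius hs1
    rw [LSeries_one_eq_riemannZeta hs1] at h
    rw [LSeries, hterm, add_comm 1 s]
    exact (inv_eq_of_mul_eq_one_right h).symm
  have hpart (n : ℕ) : ∑ k ∈ Icc 1 n, f k = (moebiusDivSum n : ℂ) := by
    simp [moebiusDivSum, f]
  have hint := LSeries_eq_mul_integral f le_rfl hs hsum (by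
    simp only [hpart, Real.rpow_zero]
    refine Asymptotics.isBigO_of_le' (c := 2) _ fun n => ?_
    simpa using abs_moebiusDivSum_le_two n)
  have himg : Real.exp '' Set.Ioi 0 = Set.Ioi 1 := by
    ext x
    constructor
    · rintro ⟨t, ht, rfl⟩
      exact Real.one_lt_exp_iff.2 ht
    · intro hx
      exact ⟨Real.log x, Real.log_pos hx, Real.exp_log (one_pos.trans hx)⟩
  rw [← himg, integral_image_eq_integral_abs_deriv_smul measurableSet_Ioi
    (fun x _ => (Real.hasDerivAt_exp x).hasDerivWithinAt) Real.exp_injective.injOn, hval] at hint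
  have hsub (t : ℝ) : |Real.exp t| • ((∑ k ∈ Icc 1 ⌊Real.exp t⌋₊, f k) *
      ((Real.exp t : ℝ) : ℂ) ^ (-(s + 1))) =
      (moebiusDivSum ⌊Real.exp t⌋₊ : ℂ) * cexp (-s * t) := by
    rw [hpart, abs_of_pos (Real.exp_pos t), Complex.real_smul, mul_left_comm,
      Complex.cpow_def_of_ne_zero (by exact_mod_cast (Real.exp_pos t).ne'), ← Complex.ofReal_log
      (Real.exp_pos t).le, Real.log_exp, Complex.ofReal_exp, ← Complex.exp_add]
    congr 2
    ring
  simp only [hsub] at hint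
  rw [invSMulZeta_apply hs0, mul_inv, hint, inv_mul_cancel_left₀ hs0,
    ← integral_Ici_eq_integral_Ioi, setIntegral_eq_integral_of_forall_compl_eq_zero]
  intro t ht
  have : ⌊Real.exp t⌋₊ = 0 := Nat.floor_eq_zero.2 (Real.exp_lt_one_iff.2 (by simpa using ht))
  simp [this, moebiusDivSum]

/-- `∑ μ(n) / n` converges to `0`; this is equivalent to the prime number theorem. -/
theorem tendsto_moebiusDivSum : Tendsto moebiusDivSum atTop (𝓝 0) := by
  have hm : Measurable fun t : ℝ => (moebiusDivSum ⌊Real.exp t⌋₊ : ℂ) :=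
    Complex.measurable_ofReal.comp
      ((measurable_from_nat (f := moebiusDivSum)).comp
        (Nat.measurable_floor.comp Real.measurable_exp))
  have h := tendsto_zero_of_laplace_continuousOn hm (M := 2)
    (fun t => by simpa using abs_moebiusDivSum_le_two _)
    (fun t ht => by
      have : ⌊Real.exp t⌋₊ = 0 := Nat.floor_eq_zero.2 (Real.exp_lt_one_iff.2 ht)
      simp [this, moebiusDivSum])
    continuousOn_invSMulZeta (fun s hs => integral_moebiusDivSum_mul_exp hs)
    (fun δ hδ => by
      obtain ⟨T₀, hT₀⟩ := moebiusDivSum_floor_exp_slowly_oscillating hδ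
      refine ⟨T₀, fun t t' ht htt' => ?_⟩
      rw [← Complex.ofReal_sub, Complex.norm_real]
      exact hT₀ t t' ht htt')
  have hlog : Tendsto (fun n : ℕ => Real.log n) atTop atTop :=
    Real.tendsto_log_atTop.comp tendsto_natCast_atTop_atTop
  have h2 := (Complex.continuous_re.tendsto 0).comp (h.comp hlog)
  refine h2.congr' ?_
  filter_upwards [eventually_ge_atTop 1] with n hn
  simp [Real.exp_log (show (0 : ℝ) < n by exact_mod_cast hn)]

end

/-! ### Mean values of products of fractional parts -/

section

open MeasureTheory Finset

/-- The sawtooth function `{x} - 1 / 2`, the fractional part centred to have mean zero. It takes the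
value `-1 / 2`, not `0`, at the integers. -/
noncomputable def sawtooth (x : ℝ) : ℝ := Int.fract x - 1 / 2

lemma sawtooth_periodic : Function.Periodic sawtooth 1 := fun x => by
  simp [sawtooth]

lemma measurable_sawtooth : Measurable sawtooth := measurable_fract.sub_const _

lemma abs_sawtooth_le (x : ℝ) : |sawtooth x| ≤ 1 / 2 := by
  rw [sawtooth, abs_le]
  have := Int.fract_nonneg x
  have := Int.fract_lt_one x
  constructor <;> linarith

lemma sum_periodic_add_div_periodic {h : ℝ → ℝ} (hh : Function.Periodic h 1) {a : ℕ}
    (ha : 0 < a) :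
    Function.Periodic (fun y => ∑ k ∈ range a, h (y + k / a)) (1 / a) := fun y => by
  have ha' : (a : ℝ) ≠ 0 := by positivity
  have h1 := sum_range_succ (fun k : ℕ => h (y + k / a)) a
  rw [sum_range_succ'] at h1
  simp only [div_self ha', hh y, Nat.cast_zero, zero_div, add_zero, add_left_inj] at h1
  refine Eq.trans (sum_congr rfl fun k _ => ?_) h1
  congr 1
  push_cast
  ring

/-- The distribution relation of the sawtooth. Both sides have period `1 / a`, so `y` may be taken in
`[0, 1 / a)`, where no fractional part wraps around. -/
lemma sum_sawtooth_add_div {a : ℕ} (ha : 0 < a) (y : ℝ) :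
    ∑ k ∈ range a, sawtooth (y + k / a) = sawtooth (a * y) := by
  have ha' : (0 : ℝ) < a := by exact_mod_cast ha
  have hper := (sum_periodic_add_div_periodic sawtooth_periodic ha).sub_int_mul_eq (x := y) ⌊a * y⌋
  have hy : y - ⌊a * y⌋ * (1 / a) = Int.fract (a * y) / a := by
    rw [Int.fract]
    field_simp
  rw [← hper]
  simp only [hy]
  set r := Int.fract (a * y) with hr
  have hr0 : 0 ≤ r := Int.fract_nonneg _
  have hr1 : r < 1 := Int.fract_lt_one _
  have hterm : ∀ k ∈ range a, sawtooth (r / a + k / a) = (r / a - 1 / 2) + k * (1 / a) := by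
    intro k hk
    have hka : (k : ℝ) + 1 ≤ a := by exact_mod_cast mem_range.1 hk
    rw [sawtooth, Int.fract_eq_self.2]
    · ring
    · rw [← add_div]
      exact ⟨by positivity, by rw [div_lt_one ha']; linarith⟩
  have hgauss : (∑ k ∈ range a, (k : ℝ)) * 2 = a * (a - 1) := by
    have := sum_range_id_mul_two a
    have h2 : ((a - 1 : ℕ) : ℝ) = a - 1 := by rw [Nat.cast_sub ha]; simp
    rw [← h2]
    rw [← Nat.cast_mul, ← this]
    push_cast
    rfl
  rw [sum_congr rfl hterm, sum_add_distrib, ← sum_mul, sawtooth, ← hr]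
  simp only [sum_const, card_range, nsmul_eq_mul]
  have : ∑ k ∈ range a, (k : ℝ) = a * (a - 1) / 2 := by linarith
  rw [this]
  field_simp
  ring

/-- Multiplication by `b` permutes the residues modulo a coprime `a`. -/
lemma sum_periodic_add_mul_div_of_coprime {h : ℝ → ℝ} (hh : Function.Periodic h 1) {a b : ℕ}
    (ha : 0 < a) (hab : a.Coprime b) (y : ℝ) :
    ∑ k ∈ range a, h (y + b * k / a) = ∑ k ∈ range a, h (y + k / a) := by
  have hinj : Set.InjOn (fun k => b * k % a) (range a : Set ℕ) := by
    intro k hk l hl hkl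
    have h1 : k ≡ l [MOD a] := Nat.ModEq.cancel_left_of_coprime hab hkl
    exact h1.eq_of_lt_of_lt (by simpa using hk) (by simpa using hl)
  have himg : (range a).image (fun k => b * k % a) = range a := by
    refine eq_of_subset_of_card_le (fun x hx => ?_) (by rw [card_image_of_injOn hinj])
    obtain ⟨k, -, rfl⟩ := mem_image.1 hx
    exact mem_range.2 (Nat.mod_lt _ ha)
  conv_rhs => rw [← himg, sum_image hinj]
  refine sum_congr rfl fun k _ => ?_
  have ha' : (a : ℝ) ≠ 0 := by positivity
  have hdm : (b : ℝ) * k = a * ((b * k / a : ℕ) : ℝ) + ((b * k % a : ℕ) : ℝ) := by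
    exact_mod_cast (Nat.div_add_mod (b * k) a).symm
  rw [hdm, ← hh.sub_nat_mul_eq (b * k / a)]
  congr 1
  field_simp
  ring

lemma integral_periodic_comp_mul {h : ℝ → ℝ} (hh : Function.Periodic h 1)
    (hi : ∀ u v, IntervalIntegrable h volume u v) {n : ℕ} (hn : 0 < n) :
    ∫ x in (0 : ℝ)..1, h (n * x) = ∫ x in (0 : ℝ)..1, h x := by
  have hn' : (n : ℝ) ≠ 0 := by positivity
  rw [intervalIntegral.integral_comp_mul_left _ hn']
  have := hh.intervalIntegral_add_zsmul_eq n 0 hi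
  simp only [zero_add, mul_zero, mul_one, zsmul_eq_mul, Int.cast_natCast] at this ⊢
  rw [this]
  simp [hn']

lemma expectedValue_eq_of_periodic {h : ℝ → ℝ} (hh : Function.Periodic h 1)
    (hi : ∀ u v, IntervalIntegrable h volume u v) {X : ℕ} (hX : 1 ≤ X) :
    expectedValue X h = ∫ x in (0 : ℝ)..1, h x := by
  have hX' : (X : ℝ) ≠ 0 := by positivity
  have := hh.intervalIntegral_add_zsmul_eq X 0 hi
  simp only [zero_add, mul_one, zsmul_eq_mul, Int.cast_natCast] at this
  rw [expectedValue, this]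
  field_simp

lemma integral_comp_fract (g : ℝ → ℝ) :
    ∫ x in (0 : ℝ)..1, g (Int.fract x) = ∫ x in (0 : ℝ)..1, g x := by
  rw [intervalIntegral.integral_of_le zero_le_one, intervalIntegral.integral_of_le zero_le_one,
    integral_Ioc_eq_integral_Ioo, integral_Ioc_eq_integral_Ioo]
  refine setIntegral_congr_fun measurableSet_Ioo fun x hx => ?_
  simp only [Int.fract_eq_self.2 ⟨hx.1.le, hx.2⟩]

lemma integral_sawtooth : ∫ x in (0 : ℝ)..1, sawtooth x = 0 := by
  have := integral_comp_fract (fun x => x - 1 / 2)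
  simp only [sawtooth, this]
  norm_num [integral_id]

lemma integral_sawtooth_sq : ∫ x in (0 : ℝ)..1, sawtooth x * sawtooth x = 1 / 12 := by
  have := integral_comp_fract (fun x => (x - 1 / 2) * (x - 1 / 2))
  simp only [sawtooth, this]
  have h2 : ∀ x : ℝ, (x - 1 / 2) * (x - 1 / 2) = (x - 1 / 2) ^ 2 := fun x => by ring
  simp only [h2]
  rw [intervalIntegral.integral_comp_sub_right (fun x => x ^ 2), integral_pow]
  norm_num

lemma intervalIntegrable_sawtooth_comp (c d : ℝ) (u v : ℝ) :
    IntervalIntegrable (fun x => sawtooth (c * x + d)) volume u v := by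
  refine (intervalIntegrable_const (c := (1 / 2 : ℝ))).mono_fun'
    (measurable_sawtooth.comp (by fun_prop)).aestronglyMeasurable
    (Filter.Eventually.of_forall fun x => abs_sawtooth_le _)

lemma intervalIntegrable_sawtooth_mul (c d c' d' : ℝ) (u v : ℝ) :
    IntervalIntegrable (fun x => sawtooth (c * x + d) * sawtooth (c' * x + d')) volume u v := by
  refine (intervalIntegrable_const (c := (1 / 2 * (1 / 2) : ℝ))).mono_fun'
    ((measurable_sawtooth.comp (by fun_prop)).mul
      (measurable_sawtooth.comp (by fun_prop))).aestronglyMeasurable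
    (Filter.Eventually.of_forall fun x => ?_)
  simp only [norm_mul]
  exact mul_le_mul (abs_sawtooth_le _) (abs_sawtooth_le _) (norm_nonneg _) (by norm_num)

lemma sawtooth_natMul_periodic (n : ℕ) : Function.Periodic (fun x => sawtooth (n * x)) 1 :=
  fun x => by
    simp only [mul_add, mul_one]
    simpa using sawtooth_periodic.nat_mul n (n * x)

/-- Averaging over the shifts `x ↦ x + k / a`, which fix `sawtooth (a * x)`, turns
`sawtooth (b * x)` into `sawtooth (a * b * x) / a` by the distribution relation; rescaling `a * x` to
`x` then removes one of the two dilations. -/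
lemma natCast_mul_integral_sawtooth_mul_sawtooth {a b : ℕ} (ha : 0 < a) (hab : a.Coprime b) :
    a * ∫ x in (0 : ℝ)..1, sawtooth (a * x) * sawtooth (b * x) =
      ∫ x in (0 : ℝ)..1, sawtooth x * sawtooth (b * x) := by
  have ha' : (a : ℝ) ≠ 0 := by positivity
  have hP : Function.Periodic (fun x => sawtooth (a * x) * sawtooth (b * x)) 1 :=
    (sawtooth_natMul_periodic a).mul (sawtooth_natMul_periodic b)
  have hshift (k : ℕ) : ∫ x in (0 : ℝ)..1, sawtooth (a * x) * sawtooth (b * x + b * k / a) =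
      ∫ x in (0 : ℝ)..1, sawtooth (a * x) * sawtooth (b * x) := by
    have h1 := intervalIntegral.integral_comp_add_right (a := 0) (b := 1)
      (fun x => sawtooth (a * x) * sawtooth (b * x)) ((k : ℝ) / a)
    have h2 := hP.intervalIntegral_add_eq ((k : ℝ) / a) 0
    rw [zero_add] at h1 h2
    rw [← h2, add_comm _ (1 : ℝ), ← h1]
    refine intervalIntegral.integral_congr fun x _ => ?_
    have h3 : (a : ℝ) * (x + k / a) = a * x + k := by field_simp
    have h4 : sawtooth (a * x + k) = sawtooth (a * x) := by
      simpa using sawtooth_periodic.nat_mul k (a * x)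
    simp only [h3, h4]
    congr 2
    ring
  calc _ = ∑ k ∈ range a, ∫ x in (0 : ℝ)..1, sawtooth (a * x) * sawtooth (b * x + b * k / a) := by
        rw [sum_congr rfl fun k _ => hshift k]
        simp
    _ = ∫ x in (0 : ℝ)..1, sawtooth (a * x) * sawtooth (b * (a * x)) := by
        rw [← intervalIntegral.integral_finsetSum fun k _ => by
          simpa using intervalIntegrable_sawtooth_mul a 0 b (b * k / a) 0 1]
        refine intervalIntegral.integral_congr fun x _ => ?_
        simp only [← mul_sum]
        rw [sum_periodic_add_mul_div_of_coprime sawtooth_periodic ha hab,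
          sum_sawtooth_add_div ha]
        congr 2
        ring
    _ = _ := integral_periodic_comp_mul
        (h := fun x => sawtooth x * sawtooth (b * x))
        (sawtooth_periodic.mul (sawtooth_natMul_periodic b))
        (fun u v => by simpa using intervalIntegrable_sawtooth_mul 1 0 b 0 u v) ha

/-- Removing the dilations by `a` and by `b` in turn leaves the mean square `1 / 12`. -/
lemma integral_sawtooth_mul_sawtooth_of_coprime {a b : ℕ} (ha : 0 < a) (hb : 0 < b)
    (hab : a.Coprime b) :
    ∫ x in (0 : ℝ)..1, sawtooth (a * x) * sawtooth (b * x) = 1 / (12 * (a * b)) := by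
  have h1 := natCast_mul_integral_sawtooth_mul_sawtooth ha hab
  have h2 := natCast_mul_integral_sawtooth_mul_sawtooth hb (Nat.coprime_one_right b)
  simp only [Nat.cast_one, one_mul, integral_sawtooth_sq] at h2
  simp only [mul_comm (sawtooth (b * _))] at h2
  have ha' : (a : ℝ) ≠ 0 := by positivity
  have hb' : (b : ℝ) ≠ 0 := by positivity
  rw [← h1] at h2
  rw [eq_div_iff (by positivity)]
  linarith

lemma integral_sawtooth_mul_sawtooth {n m : ℕ} (hn : 0 < n) (hm : 0 < m) :
    ∫ x in (0 : ℝ)..1, sawtooth (n * x) * sawtooth (m * x) =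
      (n.gcd m : ℝ) ^ 2 / (12 * (n * m)) := by
  obtain ⟨a, b, hab, ha, hb⟩ := Nat.exists_coprime n m
  set d := n.gcd m
  have hd : 0 < d := Nat.gcd_pos_of_pos_left _ hn
  have ha0 : 0 < a := Nat.pos_of_ne_zero fun h => by simp [h] at ha; omega
  have hb0 : 0 < b := Nat.pos_of_ne_zero fun h => by simp [h] at hb; omega
  have h := integral_periodic_comp_mul
    (h := fun x => sawtooth (a * x) * sawtooth (b * x))
    ((sawtooth_natMul_periodic a).mul (sawtooth_natMul_periodic b))
    (fun u v => by simpa using intervalIntegrable_sawtooth_mul a 0 b 0 u v) hd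
  rw [integral_sawtooth_mul_sawtooth_of_coprime ha0 hb0 hab] at h
  have hd' : (d : ℝ) ≠ 0 := by positivity
  rw [ha, hb]
  push_cast
  simp only [mul_assoc]
  rw [h]
  field_simp

lemma integral_fract_mul_fract {n m : ℕ} (hn : 0 < n) (hm : 0 < m) :
    ∫ x in (0 : ℝ)..1, Int.fract (n * x) * Int.fract (m * x) =
      1 / 4 + (n.gcd m : ℝ) ^ 2 / (12 * (n * m)) := by
  have hone (k : ℕ) (hk : 0 < k) : ∫ x in (0 : ℝ)..1, sawtooth (k * x) = 0 := by
    rw [integral_periodic_comp_mul sawtooth_periodic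
      (fun u v => by simpa using intervalIntegrable_sawtooth_comp 1 0 u v) hk, integral_sawtooth]
  have hint (k : ℕ) : IntervalIntegrable (fun x => sawtooth (k * x)) volume 0 1 := by
    simpa using intervalIntegrable_sawtooth_comp k 0 0 1
  have hint2 : IntervalIntegrable (fun x => sawtooth (n * x) * sawtooth (m * x)) volume 0 1 := by
    simpa using intervalIntegrable_sawtooth_mul n 0 m 0 0 1
  have hexp (x : ℝ) : Int.fract (n * x) * Int.fract (m * x) =
      sawtooth (n * x) * sawtooth (m * x) + 1 / 2 * sawtooth (n * x) + 1 / 2 * sawtooth (m * x) +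
        1 / 4 := by
    simp only [sawtooth]
    ring
  simp only [hexp]
  rw [intervalIntegral.integral_add
      ((hint2.add ((hint n).const_mul _)).add ((hint m).const_mul _)) intervalIntegrable_const,
    intervalIntegral.integral_add (hint2.add ((hint n).const_mul _)) ((hint m).const_mul _),
    intervalIntegral.integral_add hint2 ((hint n).const_mul _),
    intervalIntegral.integral_const_mul, intervalIntegral.integral_const_mul, hone n hn, hone m hm,
    integral_sawtooth_mul_sawtooth hn hm]
  simp
  ring

lemma fract_natMul_periodic (n : ℕ) : Function.Periodic (fun x : ℝ => Int.fract (n * x)) 1 :=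
  fun x => by simp [mul_add]

lemma intervalIntegrable_fract_mul (c c' u v : ℝ) :
    IntervalIntegrable (fun x => Int.fract (c * x) * Int.fract (c' * x)) volume u v := by
  refine (intervalIntegrable_const (c := (1 : ℝ))).mono_fun'
    ((measurable_fract.comp (by fun_prop)).mul
      (measurable_fract.comp (by fun_prop))).aestronglyMeasurable
    (Filter.Eventually.of_forall fun x => ?_)
  simp only [norm_mul, Real.norm_eq_abs, Int.abs_fract]
  exact mul_le_one₀ (Int.fract_lt_one _).le (Int.fract_nonneg _) (Int.fract_lt_one _).le

lemma expectedValue_fract_mul_fract {X n m : ℕ} (hX : 1 ≤ X) (hn : 0 < n) (hm : 0 < m) :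
    expectedValue X (fun x => Int.fract (n * x) * Int.fract (m * x)) =
      1 / 4 + (n.gcd m : ℝ) ^ 2 / (12 * (n * m)) := by
  rw [← integral_fract_mul_fract hn hm]
  exact expectedValue_eq_of_periodic ((fract_natMul_periodic n).mul (fract_natMul_periodic m))
    (intervalIntegrable_fract_mul n m) hX

lemma expectedValue_fract_sq {X n : ℕ} (hX : 1 ≤ X) (hn : 1 ≤ n) :
    expectedValue X (fun x => Int.fract (n * x) ^ 2) = 1 / 3 := by
  have hn' : (n : ℝ) ≠ 0 := by positivity
  simp only [pow_two]
  rw [expectedValue_fract_mul_fract hX hn hn, Nat.gcd_self]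
  field_simp
  norm_num

lemma expectedValue_sin_sq {X : ℕ} (hX : 1 ≤ X) :
    expectedValue X (fun x => Real.sin (2 * Real.pi * x) ^ 2) = 1 / 2 := by
  have hX' : (X : ℝ) ≠ 0 := by positivity
  rw [expectedValue, intervalIntegral.integral_comp_mul_left (fun x => Real.sin x ^ 2)
    (by positivity), integral_sin_sq]
  have h : Real.sin (2 * Real.pi * X) = 0 := by
    rw [show 2 * Real.pi * X = ((2 * X : ℕ) : ℝ) * Real.pi by push_cast; ring]
    exact Real.sin_nat_mul_pi _
  simp [h]
  field_simp

end

section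

open Filter Topology Finset ArithmeticFunction

/-! ### The Möbius sum over least common multiples -/

lemma hasSum_ite_dvd_one_div_sq {l : ℕ} (hl : 0 < l) :
    HasSum (fun k : ℕ => if l ∣ k then 1 / (k : ℝ) ^ 2 else 0)
      (Real.pi ^ 2 / 6 * (1 / (l : ℝ) ^ 2)) := by
  have hinj : Function.Injective (fun j : ℕ => l * j) := fun a b h => Nat.eq_of_mul_eq_mul_left hl h
  rw [← hinj.hasSum_iff fun k hk => if_neg fun ⟨j, hj⟩ => hk ⟨j, hj.symm⟩]
  have hcomp : (fun k : ℕ => if l ∣ k then 1 / (k : ℝ) ^ 2 else 0) ∘ (fun j => l * j) =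
      fun j : ℕ => 1 / (j : ℝ) ^ 2 * (1 / (l : ℝ) ^ 2) := by
    ext j
    simp only [Function.comp_apply, dvd_mul_right, if_true]
    push_cast
    ring
  rw [hcomp]
  exact hasSum_zeta_two.mul_right _

/-- Expanding the square, each pair `(n, m)` contributes the sum of `1 / k ^ 2` over the multiples `k`
of `lcm n m`. For `w = μ` this evaluates the lcm sum; for `w = 1` it bounds the divisor function. -/
lemma hasSum_sq_sum_dvd_div_sq (w : ℕ → ℝ) (N : ℕ) :
    HasSum (fun k : ℕ => (∑ n ∈ Icc 1 N, if n ∣ k then w n else 0) ^ 2 / (k : ℝ) ^ 2)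
      (Real.pi ^ 2 / 6 * ∑ n ∈ Icc 1 N, ∑ m ∈ Icc 1 N, w n * w m / (n.lcm m : ℝ) ^ 2) := by
  have h : HasSum (fun k : ℕ => ∑ n ∈ Icc 1 N, ∑ m ∈ Icc 1 N,
      w n * w m * (if n.lcm m ∣ k then 1 / (k : ℝ) ^ 2 else 0))
      (∑ n ∈ Icc 1 N, ∑ m ∈ Icc 1 N,
        w n * w m * (Real.pi ^ 2 / 6 * (1 / (n.lcm m : ℝ) ^ 2))) := by
    refine hasSum_sum fun n hn => hasSum_sum fun m hm => HasSum.mul_left _ ?_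
    exact hasSum_ite_dvd_one_div_sq (Nat.lcm_pos (mem_Icc.1 hn).1 (mem_Icc.1 hm).1)
  convert h using 1
  · ext k
    rw [pow_two, sum_mul_sum, sum_div]
    refine sum_congr rfl fun n _ => ?_
    rw [sum_div]
    refine sum_congr rfl fun m _ => ?_
    simp only [Nat.lcm_dvd_iff]
    split_ifs <;> simp_all
    ring
  · rw [mul_sum]
    refine sum_congr rfl fun n _ => ?_
    rw [mul_sum]
    refine sum_congr rfl fun m _ => ?_
    ring

/-- With `g = gcd n m`, `n = g a` and `m = g b` one has `lcm n m = g a b`, so the series is a subseries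
of the cube of `∑ 1 / k ^ 2`. -/
lemma summable_one_div_lcm_sq : Summable fun p : ℕ × ℕ => 1 / (p.1.lcm p.2 : ℝ) ^ 2 := by
  have h := hasSum_zeta_two.summable
  have h3 := h.mul_of_nonneg (h.mul_of_nonneg h (fun _ => by positivity) fun _ => by positivity)
    (fun _ => by positivity) fun _ => by positivity
  have hinj : Function.Injective
      fun p : ℕ × ℕ => (p.1.gcd p.2, p.1 / p.1.gcd p.2, p.2 / p.1.gcd p.2) := by
    rintro ⟨n, m⟩ ⟨n', m'⟩ hp
    simp only [Prod.mk.injEq] at hp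
    obtain ⟨h1, h2, h3⟩ := hp
    have e1 := Nat.mul_div_cancel' (Nat.gcd_dvd_left n m)
    have e2 := Nat.mul_div_cancel' (Nat.gcd_dvd_right n m)
    rw [h2, h1, Nat.mul_div_cancel' (Nat.gcd_dvd_left n' m')] at e1
    rw [h3, h1, Nat.mul_div_cancel' (Nat.gcd_dvd_right n' m')] at e2
    rw [← e1, ← e2]
  refine (h3.comp_injective hinj).congr fun p => ?_
  obtain ⟨n, m⟩ := p
  have hl : n.lcm m = n.gcd m * ((n / n.gcd m) * (m / n.gcd m)) := by
    rw [← mul_assoc, Nat.mul_div_cancel' (Nat.gcd_dvd_left n m), Nat.lcm,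
      Nat.mul_div_assoc _ (Nat.gcd_dvd_right n m)]
  simp only [Function.comp_apply, hl]
  push_cast
  ring

lemma summable_card_divisors_sq_div_sq :
    Summable fun k : ℕ => (#k.divisors : ℝ) ^ 2 / (k : ℝ) ^ 2 := by
  refine summable_of_sum_range_le (c := Real.pi ^ 2 / 6 *
    ∑' p : ℕ × ℕ, 1 / (p.1.lcm p.2 : ℝ) ^ 2) (fun _ => by positivity) fun K => ?_
  have h := hasSum_sq_sum_dvd_div_sq (fun _ => 1) K
  have h1 : ∑ k ∈ range K, (#k.divisors : ℝ) ^ 2 / (k : ℝ) ^ 2 ≤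
      Real.pi ^ 2 / 6 * ∑ n ∈ Icc 1 K, ∑ m ∈ Icc 1 K, 1 * 1 / (n.lcm m : ℝ) ^ 2 := by
    refine le_trans (le_of_eq (sum_congr rfl fun k hk => ?_))
      (sum_le_hasSum (range K) (fun _ _ => by positivity) h)
    rcases Nat.eq_zero_or_pos k with rfl | hk0
    · simp
    congr 2
    rw [← sum_filter, sum_const, nsmul_eq_mul, mul_one]
    congr 2
    ext n
    simp only [Nat.mem_divisors, mem_filter, mem_Icc]
    have hkK := mem_range.1 hk
    constructor
    · rintro ⟨hd, -⟩
      exact ⟨⟨Nat.pos_of_dvd_of_pos hd hk0, (Nat.le_of_dvd hk0 hd).trans hkK.le⟩, hd⟩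
    · rintro ⟨-, hd⟩
      exact ⟨hd, hk0.ne'⟩
  refine h1.trans (mul_le_mul_of_nonneg_left ?_ (by positivity))
  simp only [mul_one]
  rw [← sum_product']
  exact summable_one_div_lcm_sq.sum_le_tsum _ fun _ _ => by positivity

lemma sum_divisors_moebius_cast (k : ℕ) :
    ∑ n ∈ k.divisors, (moebius n : ℝ) = if k = 1 then 1 else 0 := by
  have h := congrArg (fun f : ArithmeticFunction ℤ => (f k : ℝ)) moebius_mul_coe_zeta
  simp only [coe_mul_zeta_apply, one_apply] at h
  push_cast at h
  exact h

lemma sum_Icc_ite_dvd {w : ℕ → ℝ} {k : ℕ} (hk : 0 < k) (N : ℕ) :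
    (∑ n ∈ Icc 1 N, if n ∣ k then w n else 0) = ∑ n ∈ k.divisors with n ≤ N, w n := by
  rw [← sum_filter]
  congr 1
  ext n
  simp only [Nat.mem_divisors, mem_filter, mem_Icc]
  constructor
  · rintro ⟨⟨-, h⟩, hd⟩
    exact ⟨⟨hd, hk.ne'⟩, h⟩
  · rintro ⟨⟨hd, -⟩, h⟩
    exact ⟨⟨Nat.pos_of_dvd_of_pos hd hk, h⟩, hd⟩

/-- The inner sums `∑ n ≤ N, n ∣ k, μ(n)` converge to the indicator of `k = 1` and are dominated by the
number of divisors of `k`, so only the term `k = 1` survives in the limit. -/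
lemma tendsto_sum_moebius_mul_moebius_div_lcm_sq :
    Tendsto (fun N : ℕ => ∑ n ∈ Icc 1 N, ∑ m ∈ Icc 1 N,
      (moebius n : ℝ) * moebius m / (n.lcm m : ℝ) ^ 2) atTop (𝓝 (6 / Real.pi ^ 2)) := by
  set c : ℕ → ℕ → ℝ := fun N k => ∑ n ∈ Icc 1 N, if n ∣ k then (moebius n : ℝ) else 0 with hc
  have hbound (N k : ℕ) : ‖c N k ^ 2 / (k : ℝ) ^ 2‖ ≤ (#k.divisors : ℝ) ^ 2 / (k : ℝ) ^ 2 := by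
    rcases Nat.eq_zero_or_pos k with rfl | hk
    · simp
    rw [norm_div, norm_pow, norm_pow, Real.norm_natCast]
    gcongr
    simp only [hc]
    rw [sum_Icc_ite_dvd hk]
    refine (norm_sum_le_of_le _ fun n _ => abs_moebius_cast_le_one n).trans ?_
    simpa using card_filter_le _ _
  have hlim (k : ℕ) : Tendsto (fun N => c N k ^ 2 / (k : ℝ) ^ 2) atTop
      (𝓝 (if k = 1 then 1 else 0)) := by
    refine tendsto_const_nhds.congr' ?_
    filter_upwards [eventually_ge_atTop k] with N hN
    rcases Nat.eq_zero_or_pos k with rfl | hk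
    · simp
    simp only [hc]
    rw [sum_Icc_ite_dvd hk, filter_true_of_mem, sum_divisors_moebius_cast k]
    · split_ifs with h <;> simp [h]
    · exact fun n hn => (Nat.divisor_le hn).trans hN
  have h := tendsto_tsum_of_dominated_convergence summable_card_divisors_sq_div_sq hlim
    (Eventually.of_forall hbound)
  rw [tsum_ite_eq] at h
  have h2 := h.const_mul (6 / Real.pi ^ 2)
  rw [mul_one] at h2
  refine h2.congr fun N => ?_
  rw [(hasSum_sq_sum_dvd_div_sq (fun n => (moebius n : ℝ)) N).tsum_eq, ← mul_assoc]
  have : 6 / Real.pi ^ 2 * (Real.pi ^ 2 / 6) = 1 := by field_simp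
  rw [this, one_mul]

/-! ### The sum of `μ(n)² / n²` -/

lemma riemannZeta_two_div_riemannZeta_four :
    riemannZeta 2 / riemannZeta 4 = ((15 / Real.pi ^ 2 : ℝ) : ℂ) := by
  have : (Real.pi : ℂ) ≠ 0 := by exact_mod_cast Real.pi_ne_zero
  rw [riemannZeta_two, riemannZeta_four]
  push_cast
  field_simp
  norm_num

/-- The Euler factors satisfy `(1 + p⁻²) (1 - p⁻⁴)⁻¹ = (1 - p⁻²)⁻¹`, so the sum times `ζ(4)` is
`ζ(2)`. -/
lemma hasSum_moebius_sq_div_sq :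
    HasSum (fun n : ℕ => (moebius n : ℝ) ^ 2 / (n : ℝ) ^ 2) (15 / Real.pi ^ 2) := by
  set f : ℕ → ℝ := fun n => (moebius n : ℝ) ^ 2 / (n : ℝ) ^ 2 with hf
  have hsum : Summable f := by
    refine hasSum_zeta_two.summable.of_nonneg_of_le (fun n => by positivity) fun n => ?_
    simp only [hf]
    gcongr
    rw [sq_le_one_iff_abs_le_one]
    exact abs_moebius_cast_le_one n
  have hprime (p : Nat.Primes) : ∑' e : ℕ, (f ((p : ℕ) ^ e) : ℂ) = 1 + ((p : ℂ) ^ 2)⁻¹ := by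
    rw [tsum_eq_sum (s := range 2)]
    · simp [sum_range_succ, hf, moebius_apply_prime p.2]
    · intro e he
      have h1 : ¬ e = 1 := by rintro rfl; simp at he
      have h0 : e ≠ 0 := by rintro rfl; simp at he
      simp [hf, moebius_apply_prime_pow p.2 h0, h1]
  have hE := EulerProduct.eulerProduct_hasProd (R := ℂ) (f := fun n => (f n : ℂ)) (by simp [hf])
    (fun {m n} hmn => by
      simp only [hf]
      rw [isMultiplicative_moebius.map_mul_of_coprime hmn]
      push_cast
      ring) (by simpa using hsum.norm) (by simp [hf])
  simp only [hprime] at hE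
  have h2 := riemannZeta_eulerProduct_hasProd (s := 2) (by simp)
  have h4 := riemannZeta_eulerProduct_hasProd (s := 4) (by simp)
  have hmul := (hE.mul h4).unique (by
    convert h2 using 2 with p
    have hp : (1 : ℝ) < (p : ℝ) := by exact_mod_cast p.2.one_lt
    have h1 : (p : ℝ) ^ 2 - 1 ≠ 0 := by nlinarith
    have h2 : (p : ℝ) ^ 2 + 1 ≠ 0 := by positivity
    have h0 : (p : ℝ) ≠ 0 := by positivity
    have key : (1 + ((p : ℝ) ^ 2)⁻¹) * (1 - ((p : ℝ) ^ 4)⁻¹)⁻¹ = (1 - ((p : ℝ) ^ 2)⁻¹)⁻¹ := by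
      have e4 : 1 - ((p : ℝ) ^ 4)⁻¹ = (1 + ((p : ℝ) ^ 2)⁻¹) * (1 - ((p : ℝ) ^ 2)⁻¹) := by
        field_simp
        ring
      rw [e4, mul_inv, mul_inv_cancel_left₀ (by positivity)]
    rw [Complex.cpow_neg, Complex.cpow_neg]
    simp only [Complex.cpow_ofNat]
    have keyC := congrArg Complex.ofReal key
    push_cast at keyC
    exact keyC)
  have hz4 : riemannZeta 4 ≠ 0 := riemannZeta_ne_zero_of_one_le_re (by simp)
  have hval : ∑' n, f n = 15 / Real.pi ^ 2 := by
    have := eq_div_of_mul_eq hz4 hmul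
    rw [riemannZeta_two_div_riemannZeta_four] at this
    exact_mod_cast this
  exact hval ▸ hsum.hasSum

/-! ### The off-diagonal sum -/

/-- The off-diagonal sum is the full square sum minus its diagonal. -/
lemma offDiagonalSum_eq {X : ℕ} (hX : 1 ≤ X) (N : ℕ) :
    offDiagonalSum X N = 1 / 4 * moebiusDivSum N ^ 2 + 1 / 12 * (∑ n ∈ Icc 1 N, ∑ m ∈ Icc 1 N,
      (moebius n : ℝ) * moebius m / (n.lcm m : ℝ) ^ 2) -
      1 / 3 * ∑ n ∈ Icc 1 N, (moebius n : ℝ) ^ 2 / (n : ℝ) ^ 2 := by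
  have hterm (n m : ℕ) (hn : 0 < n) (hm : 0 < m) :
      (moebius n * moebius m : ℝ) / (n * m) *
        expectedValue X (fun x => Int.fract (n * x) * Int.fract (m * x)) =
      1 / 4 * (moebius n / n * (moebius m / m)) +
        1 / 12 * ((moebius n : ℝ) * moebius m / (n.lcm m : ℝ) ^ 2) := by
    have hl : (n.gcd m : ℝ) * n.lcm m = n * m := by exact_mod_cast Nat.gcd_mul_lcm n m
    have hl0 : (0 : ℝ) < n.lcm m := by exact_mod_cast Nat.lcm_pos hn hm
    have hg : (n.gcd m : ℝ) = n * m / n.lcm m := by field_simp; exact hl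
    rw [expectedValue_fract_mul_fract hX hn hm, hg]
    field_simp
  have hdiag : ∑ n ∈ Icc 1 N, (moebius n * moebius n : ℝ) / (n * n) *
      expectedValue X (fun x => Int.fract (n * x) * Int.fract (n * x)) =
      1 / 3 * ∑ n ∈ Icc 1 N, (moebius n : ℝ) ^ 2 / (n : ℝ) ^ 2 := by
    rw [mul_sum]
    refine sum_congr rfl fun n hn => ?_
    have := expectedValue_fract_sq hX (mem_Icc.1 hn).1
    simp only [pow_two] at this
    rw [this]
    ring
  have hfull : ∑ p ∈ Icc 1 N ×ˢ Icc 1 N, (moebius p.1 * moebius p.2 : ℝ) / (p.1 * p.2) *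
      expectedValue X (fun x => Int.fract (p.1 * x) * Int.fract (p.2 * x)) =
      1 / 4 * moebiusDivSum N ^ 2 + 1 / 12 * (∑ n ∈ Icc 1 N, ∑ m ∈ Icc 1 N,
      (moebius n : ℝ) * moebius m / (n.lcm m : ℝ) ^ 2) := by
    rw [sum_product, pow_two, moebiusDivSum, sum_mul_sum, mul_sum, mul_sum, ← sum_add_distrib]
    refine sum_congr rfl fun n hn => ?_
    rw [mul_sum, mul_sum, ← sum_add_distrib]
    exact sum_congr rfl fun m hm => hterm n m (mem_Icc.1 hn).1 (mem_Icc.1 hm).1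
  rw [← hfull, ← hdiag, ← diag_union_offDiag, sum_union (disjoint_diag_offDiag _), sum_diag,
    offDiagonalSum]
  ring

theorem theorem1 :
    (∃ S : ℕ → ℝ,
      (∀ X : ℕ, 1 ≤ X →
        Filter.Tendsto (fun N : ℕ => offDiagonalSum X N) Filter.atTop (nhds (S X))) ∧
      (∃ C : ℝ, ∀ X : ℕ, 1 ≤ X → |S X - (-(9 / (2 * Real.pi ^ 2)))| ≤ C / (X : ℝ))) ∧
    (∃ C : ℝ, ∀ X : ℕ, 1 ≤ X →
      |expectedValue X (fun x => Real.sin (2 * Real.pi * x) ^ 2) - 1 / 2| ≤ C / (X : ℝ)) ∧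
    (∀ X : ℕ, 1 ≤ X → ∀ n : ℕ, 1 ≤ n →
      expectedValue X (fun x => Int.fract ((n : ℝ) * x) ^ 2) = 1 / 3) ∧
    (HasSum (fun n : ℕ+ => (ArithmeticFunction.moebius (n : ℕ) : ℝ) ^ 2 / ((n : ℕ) : ℝ) ^ 2)
        (15 / Real.pi ^ 2) ∧
      riemannZeta 2 / riemannZeta 4 = ((15 / Real.pi ^ 2 : ℝ) : ℂ)) := by
  -- The mean values do not depend on `X`, since the integrands have period `1`; hence `S` is constant.
  refine ⟨⟨fun _ => -(9 / (2 * Real.pi ^ 2)), fun X hX => ?_, 0, fun X _ => by simp⟩,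
    ⟨0, fun X hX => by simp [expectedValue_sin_sq hX]⟩,
    fun X hX n hn => expectedValue_fract_sq hX hn, ?_, riemannZeta_two_div_riemannZeta_four⟩
  · have hdiag : Tendsto (fun N : ℕ => ∑ n ∈ Icc 1 N, (moebius n : ℝ) ^ 2 / (n : ℝ) ^ 2) atTop
        (𝓝 (15 / Real.pi ^ 2)) := by
      refine (hasSum_moebius_sq_div_sq.tendsto_sum_nat.comp (tendsto_add_atTop_nat 1)).congr
        fun N => ?_
      rw [Function.comp_apply, range_eq_Ico, sum_eq_sum_Ico_succ_bot (by omega)]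
      simp
      rfl
    have h := (((tendsto_moebiusDivSum.pow 2).const_mul (1 / 4)).add
      (tendsto_sum_moebius_mul_moebius_div_lcm_sq.const_mul (1 / 12))).sub
      (hdiag.const_mul (1 / 3))
    simp only [← offDiagonalSum_eq hX] at h
    convert h using 2
    field_simp
    norm_num
  · refine (PNat.coe_injective.hasSum_iff fun n hn => ?_).2 hasSum_moebius_sq_div_sq
    have : n = 0 := by
      by_contra h
      exact hn ⟨⟨n, Nat.pos_of_ne_zero h⟩, rfl⟩
    simp [this]

end
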